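/- Let $G$ be a finite group generated by $g_1,\dots,g_r$, $r\ge 1$. An urn initially contains $r$ balls, labelled $g_1,\dots,g_r$. Whenever the urn contains $n\ge r$ balls, two balls are drawn uniformly at random with replacement, and one new ball, labelled with the product of the two drawn labels, is added to the urn. Let $p_{g,n}$ be the proportion of balls labelled $g$ when the urn contains $n$ balls. Then, with probability one, $p_{g,n}\to 1/|G|$ as $n\to\infty$ for every $g\in G$. Moreover, let $G^*\subset\mathbb R^G$ be the simplex of probability distributions on $G$, put $(Tp)_g=\sum_{h\in G}p_{gh^{-1}}p_h$, and for a nonempty $S\subseteq G$ let $u_S$ be the uniform distribution on $S$. Then: (a) $T$ maps $G^*$ into itself, and its fixed points in $G^*$ are exactly the distributions $u_H$ with $H$ a subgroup of $G$. (b) With the Euclidean norm, $\|T(p)-u_G\|\le\|p-u_G\|$ for every $p\in G^*$, with equality if and only if $p=u_{sH}$ for some subgroup $H$ of $G$ and some $s\in G$ with $sHs^{-1}=H$. (c) Let $H$ be a proper subgroup of $G$ and let $c\in\mathbb R^G$ be $0$ on the coordinates where $u_H$ has mass and $1$ on the others. Then the initial proportions satisfy $\langle c,p_{\cdot,r}\rangle>0$,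 and $$\liminf_{p\to u_H,\ p\in G^*,\ \langle c,p\rangle\ne0}\ \frac{\langle c,T(p)\rangle}{\langle c,p\rangle}>1 .$$ -/

import Mathlib

open MeasureTheory Filter Topology
open scoped Pointwise

namespace DiaconisUrn

/-- Relative frequency of the label `g` among `n` balls with labels `x 0, …, x (n - 1)`. -/
noncomputable def freq {G : Type*} {n : ℕ} (x : Fin n → G) (g : G) : ℝ :=
  (Nat.card {i : Fin n // x i = g} : ℝ) / n

/-- The labels of the balls in the urn at the time when it contains `n` balls. The balls are
numbered from `0`; `X k ω` is the label of ball number `k`. -/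
def content {G Ω : Type*} (X : ℕ → Ω → G) (n : ℕ) (ω : Ω) : Fin n → G :=
  fun i => X i ω

/-- When the urn holds `n` balls with labels `x`, an ordered pair of balls is drawn uniformly, with
replacement. This is the probability that the product of the two labels is `g`. -/
noncomputable def drawProb {G : Type*} [Group G] {n : ℕ} (x : Fin n → G) (g : G) : ℝ :=
  (Nat.card {d : Fin n × Fin n // x d.1 * x d.2 = g} : ℝ) / (n : ℝ) ^ 2

/-- `X 0, X 1, …` are the labels of the successive balls of the urn process started from `r` balls
labelled `gen 0, …, gen (r - 1)`: for each `n ≥ r`, given the labels `x` of the first `n` balls,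
the next ball bears the product of the labels of two balls drawn from these `n` balls with
replacement. -/
structure IsUrnProcess {G Ω : Type*} [Group G] [MeasurableSpace Ω] (P : Measure Ω)
    {r : ℕ} (gen : Fin r → G) (X : ℕ → Ω → G) : Prop where
  measurable : ∀ k g, MeasurableSet {ω | X k ω = g}
  initial : ∀ᵐ ω ∂P, content X r ω = gen
  step : ∀ n, r ≤ n → ∀ (x : Fin n → G) (g : G),
    P.real {ω | content X n ω = x ∧ X n ω = g} = P.real {ω | content X n ω = x} * drawProb x g

/-- The convolution map `T`. -/
def conv {G : Type*} [Group G] [Fintype G] (p : G → ℝ) (g : G) : ℝ :=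
  ∑ h, p (g * h⁻¹) * p h

/-- The uniform distribution on the subset `S`. -/
noncomputable def unif {G : Type*} (S : Set G) : G → ℝ :=
  S.indicator fun _ => (Nat.card S : ℝ)⁻¹

/-- The vector with `0` in the coordinates where `q` has mass and `1` in those where it has none. -/
noncomputable def offSupport {G : Type*} (q : G → ℝ) : G → ℝ :=
  {g | q g = 0}.indicator fun _ => 1

/-- The Euclidean distance in `ℝ^G`. -/
noncomputable def eDist {G : Type*} [Fintype G] (p q : G → ℝ) : ℝ :=
  ‖(WithLp.toLp 2 (p - q) : EuclideanSpace ℝ G)‖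

end DiaconisUrn

namespace DiaconisUrn

/-! Let p be the vector of proportions. Two draws with replacement are independent with law p, so
the next label has law T(p), and p moves on average by (T(p) - p)/(n + 1).

The Lyapunov function is |p|², on the simplex the squared distance to u_G plus a constant. T(p) is
the p-weighted mean of the right translates of p, so |T(p)|² ≤ |p|², the gap being a variance
(`convDefect_eq`). It vanishes only if all translates by support elements agree, which forces p to
be uniform on a coset of a subgroup; this gives (a) and (b). In the urn the expected energy drops by
at least `dissipation`/(n + 1), up to a summable error, so these terms are almost surely summable.
As `dissipation` changes by O(1/n) per step, it tends to 0. It vanishes only at the finitely many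
u_H, and a path with vanishing steps that approaches a finite set converges to one of its points.

It remains to exclude proper H. The product of an element of H and one outside H lies outside H, so
mass x outside H becomes at least 2x(1 - x), almost doubling when x is small; this gives (c). It
also makes n/(N - 1/2), with N the number of balls outside H, a supermartingale while N/n ≤ 1/8
(`drawExp_escape_le`). Convergence to u_H would send it to infinity, contradicting Fatou's lemma.
Some generator lies outside H, so N ≥ 1 throughout. -/

theorem unif_apply_of_mem {G : Type*} {S : Set G} {g : G} (h : g ∈ S) :
    unif S g = (Nat.card S : ℝ)⁻¹ := Set.indicator_of_mem h _

theorem unif_apply_of_notMem {G : Type*} {S : Set G} {g : G} (h : g ∉ S) : unif S g = 0 :=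
  Set.indicator_of_notMem h _

/-! ### Uniform distributions, energy and mass off a subset -/

section Uniform

variable {G : Type*} [Fintype G]

/-- The squared Euclidean norm. -/
def energy (p : G → ℝ) : ℝ := ∑ g, p g ^ 2

theorem energy_nonneg (p : G → ℝ) : 0 ≤ energy p := Finset.sum_nonneg fun _ _ => sq_nonneg _

theorem energy_eq_zero_iff (p : G → ℝ) : energy p = 0 ↔ p = 0 := by
  rw [energy, Finset.sum_eq_zero_iff_of_nonneg fun _ _ => sq_nonneg _]
  simp [funext_iff]

theorem unif_eq_zero_iff {S : Set G} {g : G} : unif S g = 0 ↔ g ∉ S := by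
  classical
  refine ⟨fun h hg => ?_, unif_apply_of_notMem⟩
  rw [unif, Set.indicator_of_mem hg] at h
  have : Nonempty S := ⟨⟨g, hg⟩⟩
  have : 0 < Nat.card S := Nat.card_pos
  have : (0 : ℝ) < Nat.card S := by exact_mod_cast this
  exact absurd h (inv_pos.2 this).ne'

theorem unif_mem_stdSimplex {S : Set G} (hS : S.Nonempty) : unif S ∈ stdSimplex ℝ G := by
  classical
  refine ⟨fun g => Set.indicator_nonneg (fun _ _ => by positivity) _, ?_⟩
  have : Nonempty S := hS.to_subtype
  have h0 : 0 < Nat.card S := Nat.card_pos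
  have h1 : (Nat.card S : ℝ) ≠ 0 := by exact_mod_cast h0.ne'
  simp only [unif, Set.indicator_apply, Finset.sum_ite, Finset.sum_const_zero, add_zero,
    Finset.sum_const, nsmul_eq_mul]
  rw [← Fintype.card_subtype, ← Nat.card_eq_fintype_card]
  exact mul_inv_cancel₀ h1

theorem unif_univ (g : G) : unif (Set.univ : Set G) g = 1 / (Fintype.card G : ℝ) := by
  simp [unif]

theorem eDist_unif_univ_sq [Nonempty G] {p : G → ℝ} (hp : ∑ g, p g = 1) :
    eDist p (unif Set.univ) ^ 2 = energy p - 1 / (Fintype.card G : ℝ) := by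
  have h0 : (Fintype.card G : ℝ) ≠ 0 := by exact_mod_cast Fintype.card_ne_zero
  rw [eDist, EuclideanSpace.norm_sq_eq]
  simp only [Pi.sub_apply, unif_univ, Real.norm_eq_abs, sq_abs, sub_sq, Finset.sum_sub_distrib,
    Finset.sum_add_distrib, ← Finset.mul_sum, ← Finset.sum_mul, hp, energy, Finset.sum_const,
    Finset.card_univ, nsmul_eq_mul]
  field_simp
  ring

open Classical in
theorem offSupport_unif_dotProduct (S : Set G) (p : G → ℝ) :
    offSupport (unif S) ⬝ᵥ p = ∑ g, if g ∈ S then 0 else p g := by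
  refine Finset.sum_congr rfl fun g _ => ?_
  simp only [offSupport, Set.indicator_apply, Set.mem_ofPred_eq, unif_eq_zero_iff]
  split_ifs <;> simp_all

theorem offSupport_dotProduct_nonneg {p : G → ℝ} (hp : ∀ g, 0 ≤ p g) (S : Set G) :
    0 ≤ offSupport (unif S) ⬝ᵥ p := by
  classical
  rw [offSupport_unif_dotProduct]
  exact Finset.sum_nonneg fun g _ => by split_ifs <;> simp [hp]

theorem offSupport_dotProduct_self (S : Set G) : offSupport (unif S) ⬝ᵥ unif S = 0 := by
  classical
  rw [offSupport_unif_dotProduct]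
  exact Finset.sum_eq_zero fun g _ => by
    split_ifs with h
    · rfl
    · exact unif_apply_of_notMem h

end Uniform

/-! ### The convolution map: contraction, fixed points, repulsion from subgroups -/

section Convolution

variable {G : Type*} [Group G] [Fintype G]

/-- Substituting g = k h: the law of a product of two independent draws from p is `conv p`. -/
theorem sum_mul_conv (f p : G → ℝ) :
    ∑ g, f g * conv p g = ∑ h, ∑ k, f (k * h) * p k * p h := by
  simp only [conv, Finset.mul_sum]
  rw [Finset.sum_comm]
  refine Finset.sum_congr rfl fun h _ => ?_
  rw [← Equiv.sum_comp (Equiv.mulRight h)]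
  simp [mul_assoc]

theorem sum_conv (p : G → ℝ) : ∑ g, conv p g = (∑ g, p g) ^ 2 := by
  have h := sum_mul_conv (fun _ => 1) p
  simp only [one_mul] at h
  rw [h, sq, Finset.sum_mul_sum, Finset.sum_comm]

theorem conv_nonneg {p : G → ℝ} (hp : ∀ g, 0 ≤ p g) (g : G) : 0 ≤ conv p g :=
  Finset.sum_nonneg fun _ _ => mul_nonneg (hp _) (hp _)

theorem conv_mem_stdSimplex {p : G → ℝ} (hp : p ∈ stdSimplex ℝ G) : conv p ∈ stdSimplex ℝ G :=
  ⟨conv_nonneg hp.1, by rw [sum_conv, hp.2, one_pow]⟩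

/-- The total variance, weighted by `p`, of the right translates of `p`. -/
def convDefect (p : G → ℝ) : ℝ :=
  ∑ g, ∑ h, ∑ k, p h * p k * (p (g * h⁻¹) - p (g * k⁻¹)) ^ 2

theorem sum_translate (p : G → ℝ) (h : G) : ∑ g, p (g * h⁻¹) ^ 2 = energy p :=
  Equiv.sum_comp (Equiv.mulRight h⁻¹) fun g => p g ^ 2

/-- For fixed g, `conv p g` is the p-mean of h ↦ p (g h⁻¹), and the double sum is twice its
variance. Summed over g, the second moments give `energy p`, since translation permutes the
coordinates. -/
theorem convDefect_eq {p : G → ℝ} (hp : ∑ g, p g = 1) :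
    convDefect p = 2 * (energy p - energy (conv p)) := by
  have key : ∀ g, ∑ h, ∑ k, p h * p k * (p (g * h⁻¹) - p (g * k⁻¹)) ^ 2 =
      2 * ∑ h, p h * p (g * h⁻¹) ^ 2 - 2 * conv p g ^ 2 := by
    intro g
    have e : ∀ h k, p h * p k * (p (g * h⁻¹) - p (g * k⁻¹)) ^ 2 =
        (p h * p (g * h⁻¹) ^ 2) * p k + p h * (p k * p (g * k⁻¹) ^ 2) -
          2 * ((p (g * h⁻¹) * p h) * (p (g * k⁻¹) * p k)) := fun h k => by ring
    simp only [e, Finset.sum_sub_distrib, Finset.sum_add_distrib, ← Finset.mul_sum,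
      ← Finset.sum_mul, hp, conv]
    ring
  have swap : ∑ g, ∑ h, p h * p (g * h⁻¹) ^ 2 = energy p := by
    rw [Finset.sum_comm]
    simp only [← Finset.mul_sum, sum_translate, ← Finset.sum_mul, hp, one_mul]
  rw [convDefect]
  simp only [key, Finset.sum_sub_distrib, ← Finset.mul_sum, swap]
  rw [mul_sub]; rfl

theorem convDefect_nonneg {p : G → ℝ} (hp : ∀ g, 0 ≤ p g) : 0 ≤ convDefect p :=
  Finset.sum_nonneg fun _ _ => Finset.sum_nonneg fun _ _ => Finset.sum_nonneg fun _ _ =>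
    mul_nonneg (mul_nonneg (hp _) (hp _)) (sq_nonneg _)

theorem energy_conv_le {p : G → ℝ} (hp : p ∈ stdSimplex ℝ G) : energy (conv p) ≤ energy p := by
  have h1 := convDefect_eq hp.2
  have h2 := convDefect_nonneg hp.1
  linarith

/-- If the right translates of `p` by the elements of its support agree, then `p` is uniform on a
coset of a subgroup normalized by the representative. -/
theorem exists_eq_unif_of_convDefect_eq_zero {p : G → ℝ} (hp : p ∈ stdSimplex ℝ G)
    (h0 : convDefect p = 0) :
    ∃ (H : Subgroup G) (s : G), (∀ h, h ∈ H ↔ s * h * s⁻¹ ∈ H) ∧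
      p = unif (s • (H : Set G)) := by
  classical
  have inv : ∀ g h k, p h ≠ 0 → p k ≠ 0 → p (g * h⁻¹) = p (g * k⁻¹) := by
    intro g h k hh hk
    have nn : ∀ g h k, 0 ≤ p h * p k * (p (g * h⁻¹) - p (g * k⁻¹)) ^ 2 := fun g h k =>
      mul_nonneg (mul_nonneg (hp.1 _) (hp.1 _)) (sq_nonneg _)
    have h1 := (Finset.sum_eq_zero_iff_of_nonneg fun g _ => Finset.sum_nonneg fun h _ =>
      Finset.sum_nonneg fun k _ => nn g h k).1 h0 g (Finset.mem_univ _)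
    have h2 := (Finset.sum_eq_zero_iff_of_nonneg fun h _ =>
      Finset.sum_nonneg fun k _ => nn g h k).1 h1 h (Finset.mem_univ _)
    have h3 := (Finset.sum_eq_zero_iff_of_nonneg fun k _ => nn g h k).1 h2 k (Finset.mem_univ _)
    rcases mul_eq_zero.1 h3 with h4 | h4
    · exact absurd h4 (mul_ne_zero hh hk)
    · exact sub_eq_zero.1 (pow_eq_zero_iff (two_ne_zero) |>.1 h4)
  -- The stabilizer of p under right translation; its left coset through a support point s will be
  -- the whole support.
  let H : Subgroup G :=
    { carrier := {k | ∀ g, p (g * k) = p g}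
      one_mem' := fun g => by rw [mul_one]
      mul_mem' := fun {a b} ha hb g => by rw [← mul_assoc, hb, ha]
      inv_mem' := fun {a} ha g => by rw [← ha (g * a⁻¹), inv_mul_cancel_right] }
  have memH : ∀ k, k ∈ H ↔ ∀ g, p (g * k) = p g := fun _ => Iff.rfl
  obtain ⟨s, hs⟩ : ∃ s, p s ≠ 0 := by
    by_contra! h
    have := hp.2
    simp [h] at this
  have supp_sub : ∀ x, p x ≠ 0 → x * s⁻¹ ∈ H := by
    intro x hx
    rw [memH]
    intro g
    rw [← mul_assoc, inv (g * x) s x hs hx, mul_inv_cancel_right]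
  have conj_mem : ∀ h ∈ H, s * h * s⁻¹ ∈ H := fun h hh =>
    supp_sub _ (by rw [(memH h).1 hh]; exact hs)
  have conj_iff : ∀ h, h ∈ H ↔ s * h * s⁻¹ ∈ H := by
    intro h
    refine ⟨conj_mem h, fun hh => ?_⟩
    -- Conjugation by s maps the finite group H injectively into itself, hence onto itself.
    have inj : Function.Injective fun k : H => (⟨s * k * s⁻¹, conj_mem k k.2⟩ : H) := by
      intro a b hab
      simpa using hab
    obtain ⟨k, hk⟩ := Finite.surjective_of_injective inj ⟨_, hh⟩
    have : (k : G) = h := by simpa using hk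
    exact this ▸ k.2
  have supp : ∀ x, p x ≠ 0 ↔ x ∈ s • (H : Set G) := by
    intro x
    rw [Set.mem_smul_set_iff_inv_smul_mem, smul_eq_mul, SetLike.mem_coe]
    constructor
    · intro hx
      rw [conj_iff]
      simpa using supp_sub x hx
    · intro hx
      have := (memH _).1 hx s
      rw [mul_inv_cancel_left] at this
      rwa [this]
  refine ⟨H, s, conj_iff, ?_⟩
  have const : ∀ x, p x = p s * (s • (H : Set G)).indicator (fun _ => 1) x := by
    intro x
    by_cases hx : x ∈ s • (H : Set G)
    · rw [Set.indicator_of_mem hx, mul_one]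
      rw [Set.mem_smul_set_iff_inv_smul_mem, smul_eq_mul, SetLike.mem_coe] at hx
      have := (memH _).1 hx s
      rwa [mul_inv_cancel_left] at this
    · rw [Set.indicator_of_notMem hx, mul_zero]
      by_contra h
      exact hx ((supp x).1 h)
  have hu := unif_mem_stdSimplex (S := s • (H : Set G)) ⟨s, (supp s).1 hs⟩
  have ueq : ∀ x, unif (s • (H : Set G)) x =
      (Nat.card (s • (H : Set G) : Set G) : ℝ)⁻¹ * (s • (H : Set G)).indicator (fun _ => 1) x := by
    intro x
    simp [unif, Set.indicator_apply]
  -- Both functions are multiples of the same indicator with total mass 1, so the multiples agree.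
  have h1 := hp.2
  have h2 := hu.2
  simp only [ueq, ← Finset.mul_sum] at h2
  rw [Finset.sum_congr rfl fun x _ => const x, ← Finset.mul_sum] at h1
  funext x
  rw [const, ueq]
  congr 1
  exact mul_right_cancel₀ (right_ne_zero_of_mul_eq_one h1) (h1.trans h2.symm)

/-- For h, k in sH, the quotient k h⁻¹ lies in sHs⁻¹ = H, so g h⁻¹ and g k⁻¹ share a left coset of
H. -/
theorem convDefect_unif_coset {H : Subgroup G} {s : G} (hs : ∀ h, h ∈ H ↔ s * h * s⁻¹ ∈ H) :
    convDefect (unif (s • (H : Set G))) = 0 := by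
  refine Finset.sum_eq_zero fun g _ => Finset.sum_eq_zero fun h _ =>
    Finset.sum_eq_zero fun k _ => ?_
  by_cases hh : h ∈ s • (H : Set G)
  swap
  · rw [unif_apply_of_notMem hh]; ring
  by_cases hk : k ∈ s • (H : Set G)
  swap
  · rw [unif_apply_of_notMem hk]; ring
  have key : g * h⁻¹ ∈ s • (H : Set G) ↔ g * k⁻¹ ∈ s • (H : Set G) := by
    rw [Set.mem_smul_set_iff_inv_smul_mem, smul_eq_mul, SetLike.mem_coe] at *
    rw [Set.mem_smul_set_iff_inv_smul_mem, smul_eq_mul, SetLike.mem_coe]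
    have hkh : k * h⁻¹ ∈ H := by
      have := (hs _).1 (H.mul_mem hk (H.inv_mem hh))
      simpa [mul_assoc] using this
    have e : s⁻¹ * (g * h⁻¹) = s⁻¹ * (g * k⁻¹) * (k * h⁻¹) := by group
    rw [e, H.mul_mem_cancel_right hkh]
  have : unif (s • (H : Set G)) (g * h⁻¹) = unif (s • (H : Set G)) (g * k⁻¹) := by
    by_cases h1 : g * h⁻¹ ∈ s • (H : Set G)
    · rw [unif_apply_of_mem h1, unif_apply_of_mem (key.1 h1)]
    · rw [unif_apply_of_notMem h1, unif_apply_of_notMem (mt key.2 h1)]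
  rw [this]; ring

theorem conv_unif_subgroup (H : Subgroup G) : conv (unif (H : Set G)) = unif (H : Set G) := by
  funext g
  have : ∀ h, unif (H : Set G) (g * h⁻¹) * unif (H : Set G) h =
      unif (H : Set G) g * unif (H : Set G) h := by
    intro h
    by_cases hh : h ∈ H
    · by_cases hg : g ∈ H
      · rw [unif_apply_of_mem (SetLike.mem_coe.2 hg),
          unif_apply_of_mem (SetLike.mem_coe.2 (H.mul_mem hg (H.inv_mem hh)))]
      · rw [unif_apply_of_notMem (g := g) hg, unif_apply_of_notMem]
        rwa [SetLike.mem_coe, H.mul_mem_cancel_right (H.inv_mem hh)]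
    · rw [unif_apply_of_notMem (g := h) hh, mul_zero, mul_zero]
  rw [conv, Finset.sum_congr rfl fun h _ => this h, ← Finset.mul_sum,
    (unif_mem_stdSimplex ⟨1, H.one_mem⟩).2, mul_one]

/-- A fixed point has zero defect, hence is uniform on some sH. Its support also contains s², so s ∈
H and the coset is H itself. -/
theorem exists_eq_unif_of_conv_eq {p : G → ℝ} (hp : p ∈ stdSimplex ℝ G) (h : conv p = p) :
    ∃ H : Subgroup G, p = unif (H : Set G) := by
  have h0 : convDefect p = 0 := by rw [convDefect_eq hp.2, h]; ring
  obtain ⟨H, s, -, rfl⟩ := exists_eq_unif_of_convDefect_eq_zero hp h0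
  have hs : s ∈ s • (H : Set G) := by
    rw [Set.mem_smul_set_iff_inv_smul_mem]; simp [H.one_mem]
  have hs0 : 0 < unif (s • (H : Set G)) s :=
    lt_of_le_of_ne (hp.1 s) (Ne.symm (mt unif_eq_zero_iff.1 (not_not.2 hs)))
  have pos : 0 < conv (unif (s • (H : Set G))) (s * s) := by
    refine Finset.sum_pos' (fun _ _ => mul_nonneg (hp.1 _) (hp.1 _)) ⟨s, Finset.mem_univ _, ?_⟩
    rw [mul_inv_cancel_right]
    exact mul_pos hs0 hs0
  rw [h] at pos
  have hss : s * s ∈ s • (H : Set G) := not_not.1 (mt unif_eq_zero_iff.2 pos.ne')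
  rw [Set.mem_smul_set_iff_inv_smul_mem, smul_eq_mul, inv_mul_cancel_left, SetLike.mem_coe] at hss
  refine ⟨H, ?_⟩
  congr 1
  ext x
  rw [Set.mem_smul_set_iff_inv_smul_mem, smul_eq_mul, SetLike.mem_coe, SetLike.mem_coe,
    H.mul_mem_cancel_left (H.inv_mem hss)]

/-- The squared distance from `p` to the uniform distribution decreases along `T` at this rate. -/
def dissipation (p : G → ℝ) : ℝ := energy p - ∑ g, p g * conv p g

/-- Polarization. On the simplex both the energy gap and the last term are nonnegative, so zero
dissipation forces `conv p = p`. -/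
theorem two_mul_dissipation (p : G → ℝ) :
    2 * dissipation p = energy p - energy (conv p) + energy (conv p - p) := by
  simp only [dissipation, energy, Pi.sub_apply, sub_sq, Finset.sum_sub_distrib,
    Finset.sum_add_distrib, mul_assoc, ← Finset.mul_sum, mul_comm (conv p _)]
  ring

theorem dissipation_nonneg {p : G → ℝ} (hp : p ∈ stdSimplex ℝ G) : 0 ≤ dissipation p := by
  have h1 := two_mul_dissipation p
  have h2 := energy_conv_le hp
  have h3 := energy_nonneg (conv p - p)
  linarith

theorem exists_eq_unif_of_dissipation_eq_zero {p : G → ℝ} (hp : p ∈ stdSimplex ℝ G)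
    (h : dissipation p = 0) : ∃ H : Subgroup G, p = unif (H : Set G) := by
  have h1 := two_mul_dissipation p
  have h2 := energy_conv_le hp
  have h3 := energy_nonneg (conv p - p)
  have h4 : energy (conv p - p) = 0 := by linarith
  exact exists_eq_unif_of_conv_eq hp (sub_eq_zero.1 ((energy_eq_zero_iff _).1 h4))

theorem continuous_dissipation : Continuous (dissipation : (G → ℝ) → ℝ) := by
  unfold dissipation energy conv
  fun_prop

theorem eDist_conv_le {p : G → ℝ} (hp : p ∈ stdSimplex ℝ G) :
    eDist (conv p) (unif Set.univ) ≤ eDist p (unif Set.univ) := by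
  refine (sq_le_sq₀ (norm_nonneg _) (norm_nonneg _)).1 ?_
  change eDist _ _ ^ 2 ≤ eDist _ _ ^ 2
  rw [eDist_unif_univ_sq hp.2, eDist_unif_univ_sq (conv_mem_stdSimplex hp).2]
  linarith [energy_conv_le hp]

theorem eDist_conv_eq_iff {p : G → ℝ} (hp : p ∈ stdSimplex ℝ G) :
    eDist (conv p) (unif Set.univ) = eDist p (unif Set.univ) ↔
      ∃ (H : Subgroup G) (s : G), (∀ h, h ∈ H ↔ s * h * s⁻¹ ∈ H) ∧
        p = unif (s • (H : Set G)) := by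
  have h1 : eDist (conv p) (unif Set.univ) = eDist p (unif Set.univ) ↔ convDefect p = 0 := by
    rw [← sq_eq_sq₀ (norm_nonneg _ : 0 ≤ eDist _ _) (norm_nonneg _ : 0 ≤ eDist _ _),
      eDist_unif_univ_sq hp.2, eDist_unif_univ_sq (conv_mem_stdSimplex hp).2, convDefect_eq hp.2]
    constructor <;> intro h <;> linarith
  rw [h1]
  refine ⟨exists_eq_unif_of_convDefect_eq_zero hp, ?_⟩
  rintro ⟨H, s, hs, rfl⟩
  exact convDefect_unif_coset hs

/-- The product of an element inside a subgroup with one outside lies outside. -/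
theorem le_offSupport_dotProduct_conv (H : Subgroup G) {p : G → ℝ} (hp : p ∈ stdSimplex ℝ G) :
    2 * (offSupport (unif (H : Set G)) ⬝ᵥ p) * (1 - offSupport (unif (H : Set G)) ⬝ᵥ p) ≤
      offSupport (unif (H : Set G)) ⬝ᵥ conv p := by
  classical
  set c : G → ℝ := offSupport (unif (H : Set G)) with hc
  have cval : ∀ g, c g = if g ∈ H then 0 else 1 := by
    intro g
    simp only [hc, offSupport, Set.indicator_apply, Set.mem_ofPred_eq, unif_eq_zero_iff,
      SetLike.mem_coe]
    split_ifs <;> simp_all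
  have e1 : c ⬝ᵥ conv p = ∑ h, ∑ k, c (k * h) * p k * p h := sum_mul_conv c p
  -- The probability that exactly one of two independent draws lies outside H.
  have e2 : 2 * (c ⬝ᵥ p) * (1 - c ⬝ᵥ p) =
      ∑ h, ∑ k, (c k * p k * ((1 - c h) * p h) + (1 - c k) * p k * (c h * p h)) := by
    have h1 : ∑ g, (1 - c g) * p g = 1 - c ⬝ᵥ p := by
      simp only [sub_mul, one_mul, Finset.sum_sub_distrib, hp.2, dotProduct]
    have h2 : ∑ g, c g * p g = c ⬝ᵥ p := rfl
    simp only [Finset.sum_add_distrib, ← Finset.mul_sum, ← Finset.sum_mul, h1, h2]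
    ring
  rw [e1, e2]
  refine Finset.sum_le_sum fun h _ => Finset.sum_le_sum fun k _ => ?_
  have hpp := mul_nonneg (hp.1 k) (hp.1 h)
  rw [cval, cval, cval]
  by_cases hh : h ∈ H
  · simp only [H.mul_mem_cancel_right hh, hh]
    split_ifs <;> simp
  · by_cases hk : k ∈ H
    · simp [H.mul_mem_cancel_left hk, hh, hk]
    · simp only [hh, hk]
      split_ifs <;> simp [hpp]

/-- The ratio is at least 2(1 - x), where x is the mass outside H; near u_H one has x < 1/4, which
gives the bound 3/2. -/
theorem one_lt_liminf_offSupport_ratio (H : Subgroup G) :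
    1 < liminf
      (fun p : G → ℝ =>
        (((offSupport (unif (H : Set G)) ⬝ᵥ conv p) / (offSupport (unif (H : Set G)) ⬝ᵥ p) : ℝ) :
          EReal))
      (𝓝[{p | p ∈ stdSimplex ℝ G ∧ offSupport (unif (H : Set G)) ⬝ᵥ p ≠ 0}]
        (unif (H : Set G))) := by
  classical
  have hcont : Continuous fun p : G → ℝ => offSupport (unif (H : Set G)) ⬝ᵥ p := by
    unfold dotProduct; fun_prop
  have h0 := offSupport_dotProduct_self (H : Set G)
  have hev : ∀ᶠ p in 𝓝 (unif (H : Set G)), offSupport (unif (H : Set G)) ⬝ᵥ p < 1 / 4 :=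
    hcont.continuousAt.eventually_lt continuousAt_const (by rw [h0]; norm_num)
  refine lt_of_lt_of_le (b := ((3 / 2 : ℝ) : EReal)) ?_ (le_liminf_of_le (by isBoundedDefault) ?_)
  · rw [← EReal.coe_one, EReal.coe_lt_coe_iff]; norm_num
  · filter_upwards [mem_nhdsWithin_of_mem_nhds hev, self_mem_nhdsWithin] with p hp1 hp2
    rw [EReal.coe_le_coe_iff]
    have hpos := lt_of_le_of_ne (offSupport_dotProduct_nonneg hp2.1.1 (H : Set G)) (Ne.symm hp2.2)
    rw [le_div_iff₀ hpos]
    have := le_offSupport_dotProduct_conv H hp2.1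
    have hp1' : offSupport (unif (H : Set G)) ⬝ᵥ p < 1 / 4 := hp1
    nlinarith

end Convolution

/-! ### Real sequences and convergence to a point of a finite set -/

section Deterministic

/-- A nonnegative sequence with increments `O(1 / n)` that is summable against `1 / n` tends
to zero. -/
theorem tendsto_zero_of_summable_div {a : ℕ → ℝ} (ha : ∀ n, 0 ≤ a n) {C : ℝ}
    (hC : ∀ n : ℕ, |a (n + 1) - a n| ≤ C / (n + 1))
    (hs : Summable fun n : ℕ => a n / (n + 1)) : Tendsto a atTop (𝓝 0) := by
  have hC0 : 0 ≤ C := by simpa using (abs_nonneg _).trans (hC 0)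
  have hsq : Summable fun n : ℕ => 1 / ((n : ℝ) + 1) ^ 2 := by
    have := (summable_nat_add_iff 1).2 (Real.summable_one_div_nat_pow.2 one_lt_two)
    simpa using this
  -- The increments of a are only O(1/n), but those of a² are O(a n / n + 1/n²), which is summable.
  have hcauchy : CauchySeq fun n => a n ^ 2 := by
    apply cauchySeq_of_summable_dist
    refine Summable.of_nonneg_of_le (fun _ => dist_nonneg) (fun n => ?_)
      ((hs.mul_left (2 * C)).add (hsq.mul_left (C ^ 2)))
    have hn : (0 : ℝ) < (n : ℝ) + 1 := by positivity
    rw [dist_comm, Real.dist_eq, sq_sub_sq, abs_mul,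
      abs_of_nonneg (add_nonneg (ha n.succ) (ha n))]
    have h1 := hC n
    have h2 : a (n + 1) + a n ≤ 2 * a n + C / (n + 1) := by
      have := (abs_le.1 h1).2
      linarith
    calc (a (n + 1) + a n) * |a (n + 1) - a n| ≤ (2 * a n + C / (n + 1)) * (C / (n + 1)) := by
          gcongr
          have := ha n
          positivity
      _ = _ := by field_simp
  obtain ⟨l, hl⟩ := cauchySeq_tendsto_of_complete hcauchy
  have hl' : Tendsto a atTop (𝓝 √l) := by
    have := (Real.continuous_sqrt.tendsto l).comp hl
    refine this.congr fun n => ?_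
    simp [Real.sqrt_sq (ha n)]
  rcases (Real.sqrt_nonneg l).eq_or_lt with h0 | h0
  · rwa [← h0] at hl'
  -- A positive limit would make the harmonic series converge.
  exfalso
  have hev : ∀ᶠ n in atTop, √l / 2 < a n := hl'.eventually (lt_mem_nhds (half_lt_self h0))
  have hsum : Summable fun n : ℕ => (√l / 2) * (1 / ((n : ℝ) + 1)) := by
    refine Summable.of_norm_bounded_eventually_nat hs ?_
    filter_upwards [hev] with n hn
    have hn1 : (0 : ℝ) < (n : ℝ) + 1 := by positivity
    rw [Real.norm_of_nonneg (by positivity), mul_one_div]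
    gcongr
  rw [summable_mul_left_iff (by positivity)] at hsum
  refine Real.not_summable_one_div_natCast ((summable_nat_add_iff 1).1 ?_)
  simpa using hsum

/-- A sequence with vanishing steps that approaches a finite set converges to one of its points. -/
theorem exists_tendsto_of_infDist_finite {α : Type*} [MetricSpace α] {F : Set α} (hF : F.Finite)
    (hne : F.Nonempty) {x : ℕ → α} (hx : Tendsto (fun n => Metric.infDist (x n) F) atTop (𝓝 0))
    (hstep : Tendsto (fun n => dist (x n) (x (n + 1))) atTop (𝓝 0)) :
    ∃ f ∈ F, Tendsto x atTop (𝓝 f) := by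
  choose f hf hfd using fun n => hF.isCompact.exists_infDist_eq_dist hne (x n)
  simp only [hfd] at hx
  have hd : Tendsto (fun n => dist (f n) (f (n + 1))) atTop (𝓝 0) := by
    have h := (hx.add hstep).add (hx.comp (tendsto_add_atTop_nat 1))
    simp only [add_zero] at h
    refine squeeze_zero (fun _ => dist_nonneg) (fun n => ?_) h
    have h1 := dist_triangle4 (f n) (x n) (x (n + 1)) (f (n + 1))
    rw [dist_comm (f n) (x n)] at h1
    exact h1
  obtain ⟨d, hd0, hsep⟩ : ∃ d > 0, ∀ u ∈ F, ∀ v ∈ F, dist u v < d → u = v := by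
    rcases F.subsingleton_or_nontrivial with h | h
    · exact ⟨1, one_pos, fun u hu v hv _ => h hu hv⟩
    · refine ⟨F.infsep, hF.infsep_pos_iff_nontrivial.2 h, fun u hu v hv huv => ?_⟩
      by_contra hne
      exact absurd (Set.infsep_le_dist_of_mem hu hv hne) (not_le.2 huv)
  obtain ⟨N, hN⟩ := eventually_atTop.1 (hd.eventually (gt_mem_nhds hd0))
  have hconst : ∀ n, N ≤ n → f n = f N := by
    intro n hn
    induction n, hn using Nat.le_induction with
    | base => rfl
    | succ n hn ih => rw [← ih]; exact (hsep _ (hf n) _ (hf _) (hN n hn)).symm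
  refine ⟨f N, hf N, tendsto_iff_dist_tendsto_zero.2 (hx.congr' ?_)⟩
  filter_upwards [eventually_ge_atTop N] with n hn
  rw [hconst n hn]

/-- If a continuous function is positive on a compact set off `F` and tends to zero along a
sequence in the compact set, then the sequence approaches `F`. -/
theorem tendsto_infDist_of_tendsto_zero {α : Type*} [MetricSpace α] {K F : Set α}
    (hK : IsCompact K) {φ : α → ℝ} (hφ : Continuous φ) (hpos : ∀ z ∈ K, z ∉ F → 0 < φ z)
    {x : ℕ → α} (hxK : ∀ᶠ n in atTop, x n ∈ K)
    (hx : Tendsto (fun n => φ (x n)) atTop (𝓝 0)) :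
    Tendsto (fun n => Metric.infDist (x n) F) atTop (𝓝 0) := by
  rw [Metric.tendsto_atTop']
  intro e he
  let K' := K ∩ {z | e ≤ Metric.infDist z F}
  have hK' : IsCompact K' :=
    hK.inter_right (isClosed_le continuous_const (Metric.continuous_infDist_pt F))
  have hpos' : ∀ z ∈ K', 0 < φ z := fun z hz => hpos z hz.1 fun hzF => by
    have := hz.2
    rw [Set.mem_ofPred_eq, Metric.infDist_zero_of_mem hzF] at this
    linarith
  obtain ⟨m, hm, hmK⟩ : ∃ m > 0, ∀ z ∈ K', m ≤ φ z := by
    rcases K'.eq_empty_or_nonempty with h | h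
    · exact ⟨1, one_pos, by simp [h]⟩
    · obtain ⟨z, hz, hmin⟩ := hK'.exists_isMinOn h hφ.continuousOn
      exact ⟨φ z, hpos' z hz, fun w hw => hmin hw⟩
  obtain ⟨N, hN⟩ := eventually_atTop.1 (hxK.and (hx.eventually (gt_mem_nhds hm)))
  refine ⟨N, fun n hn => ?_⟩
  obtain ⟨h1, h2⟩ := hN n hn.le
  rw [Real.dist_0_eq_abs, abs_of_nonneg Metric.infDist_nonneg]
  by_contra! h
  exact absurd (hmK _ ⟨h1, h⟩) (not_le.2 h2)

end Deterministic

/-! ### Label frequencies and counts along a sequence -/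

section Counting

variable {G : Type*}

open Classical in
theorem freq_eq_sum {n : ℕ} (x : Fin n → G) (g : G) :
    freq x g = (∑ i, if x i = g then (1 : ℝ) else 0) / n := by
  rw [freq, Nat.card_eq_fintype_card, Fintype.card_subtype, Finset.natCast_card_filter]

theorem freq_nonneg {n : ℕ} (x : Fin n → G) (g : G) : 0 ≤ freq x g := by
  rw [freq]; positivity

theorem sum_freq_mul [Fintype G] {n : ℕ} (x : Fin n → G) (f : G → ℝ) :
    ∑ g, f g * freq x g = (∑ i, f (x i)) / n := by
  classical
  simp only [freq_eq_sum, mul_div_assoc', Finset.mul_sum, ← Finset.sum_div]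
  rw [Finset.sum_comm]
  simp

theorem freq_mem_stdSimplex [Fintype G] {n : ℕ} (hn : 0 < n) (x : Fin n → G) :
    freq x ∈ stdSimplex ℝ G := by
  refine ⟨freq_nonneg x, ?_⟩
  have h := sum_freq_mul x fun _ => 1
  have hn' : (n : ℝ) ≠ 0 := by exact_mod_cast hn.ne'
  simpa [hn'] using h

/-- The link between the urn and T: count pairs of balls by fixing the second one. With n = 0 both
sides are 0. -/
theorem drawProb_eq_conv [Group G] [Fintype G] {n : ℕ} (x : Fin n → G) (g : G) :
    drawProb x g = conv (freq x) g := by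
  classical
  have h1 : conv (freq x) g = (∑ j, ∑ i, if x i * x j = g then (1 : ℝ) else 0) / n ^ 2 := by
    rw [conv, sum_freq_mul x fun h => freq x (g * h⁻¹)]
    simp only [freq_eq_sum, ← Finset.sum_div, eq_mul_inv_iff_mul_eq]
    rw [div_div, sq]
  rw [h1, drawProb, Nat.card_eq_fintype_card, Fintype.card_subtype, Finset.natCast_card_filter,
    Fintype.sum_prod_type_right]

/-- The label proportions among the first `n` terms of a sequence. -/
noncomputable def pathFreq (n : ℕ) (y : ℕ → G) : G → ℝ := freq fun i : Fin n => y i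

/-- The number of the first `n` terms of a sequence that avoid `S`. -/
noncomputable def countOutside (S : Set G) (n : ℕ) (y : ℕ → G) : ℝ :=
  ∑ i ∈ Finset.range n, Sᶜ.indicator (fun _ => (1 : ℝ)) (y i)

theorem countOutside_succ (S : Set G) (n : ℕ) (y : ℕ → G) :
    countOutside S (n + 1) y = countOutside S n y + Sᶜ.indicator (fun _ => (1 : ℝ)) (y n) :=
  Finset.sum_range_succ _ _

theorem countOutside_mono (S : Set G) (y : ℕ → G) : Monotone fun n => countOutside S n y :=
  monotone_nat_of_le_succ fun n => by
    rw [countOutside_succ]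
    exact le_add_of_nonneg_right (Set.indicator_nonneg (fun _ _ => zero_le_one) _)

theorem dependsOn_countOutside (S : Set G) (n : ℕ) :
    DependsOn (countOutside S n) (Set.Iio n) := fun _ _ h =>
  Finset.sum_congr rfl fun i hi => by rw [h i (Finset.mem_range.1 hi)]

theorem dependsOn_pathFreq (n : ℕ) :
    DependsOn (pathFreq n : (ℕ → G) → G → ℝ) (Set.Iio n) := fun x y h => by
  have : (fun i : Fin n => x i) = fun i : Fin n => y i := funext fun i => h i i.2
  rw [pathFreq, pathFreq, this]

theorem DependsOn.update_eq {β : Type*} {F : (ℕ → G) → β} {n : ℕ} (hF : DependsOn F (Set.Iio n))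
    (y : ℕ → G) {k : ℕ} (hk : n ≤ k) (g : G) : F (Function.update y k g) = F y :=
  hF fun _ hi => Function.update_of_ne ((Set.mem_Iio.1 hi).trans_le hk).ne _ _

theorem offSupport_dotProduct_freq [Fintype G] (S : Set G) (n : ℕ) (y : ℕ → G) :
    offSupport (unif S) ⬝ᵥ pathFreq n y = countOutside S n y / n := by
  classical
  rw [pathFreq, dotProduct, sum_freq_mul]
  rw [countOutside, ← Fin.sum_univ_eq_sum_range]
  congr 1
  refine Finset.sum_congr rfl fun i _ => ?_
  simp only [offSupport, Set.indicator_apply, Set.mem_ofPred_eq, unif_eq_zero_iff,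
    Set.mem_compl_iff]

theorem mul_pathFreq_succ (n : ℕ) (y : ℕ → G) (g : G) [Decidable (y n = g)] :
    (n + 1) * pathFreq (n + 1) y g = n * pathFreq n y g + if y n = g then 1 else 0 := by
  classical
  have h : ∀ m : ℕ, (m : ℝ) * pathFreq m y g =
      ∑ i ∈ Finset.range m, if y i = g then (1 : ℝ) else 0 := by
    intro m
    rw [pathFreq, freq_eq_sum, Fin.sum_univ_eq_sum_range fun i => if y i = g then (1 : ℝ) else 0]
    rcases m.eq_zero_or_pos with rfl | hm
    · simp
    · field_simp
  have h1 := h (n + 1)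
  rw [Finset.sum_range_succ, ← h n] at h1
  push_cast at h1
  rw [h1]
  congr

theorem pathFreq_nonneg (n : ℕ) (y : ℕ → G) (g : G) : 0 ≤ pathFreq n y g := freq_nonneg _ g

theorem pathFreq_le_one (n : ℕ) (y : ℕ → G) (g : G) : pathFreq n y g ≤ 1 := by
  classical
  rw [pathFreq, freq_eq_sum]
  refine div_le_one_of_le₀ ?_ (by positivity)
  calc (∑ i : Fin n, if y i = g then (1 : ℝ) else 0) ≤ ∑ i : Fin n, 1 :=
        Finset.sum_le_sum fun i _ => by split_ifs <;> norm_num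
    _ = n := by simp

theorem abs_pathFreq_succ_sub_le (n : ℕ) (y : ℕ → G) (g : G) :
    |pathFreq (n + 1) y g - pathFreq n y g| ≤ 1 / (n + 1) := by
  classical
  have h := mul_pathFreq_succ n y g
  have h0 := pathFreq_nonneg n y g
  have h1 := pathFreq_le_one n y g
  have hn : (0 : ℝ) < (n : ℝ) + 1 := by positivity
  have e : |pathFreq (n + 1) y g - pathFreq n y g| * (n + 1) =
      |(pathFreq (n + 1) y g - pathFreq n y g) * (n + 1)| := by rw [abs_mul, abs_of_pos hn]
  rw [le_div_iff₀ hn, e, abs_le]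
  split_ifs at h <;> constructor <;> linarith

end Counting

/-! ### Lipschitz bound for the dissipation -/

section Lipschitz

variable {G : Type*} [Group G] [Fintype G]

/-- Each of the |G| quadratic monomials moves by at most 2δ, each of the |G|² cubic ones by at most
3δ. -/
theorem abs_dissipation_sub_le {p q : G → ℝ} {δ : ℝ} (hp : ∀ g, |p g| ≤ 1) (hq : ∀ g, |q g| ≤ 1)
    (h : ∀ g, |p g - q g| ≤ δ) :
    |dissipation p - dissipation q| ≤
      (2 * Fintype.card G + 3 * (Fintype.card G : ℝ) ^ 2) * δ := by
  have hδ : 0 ≤ δ := (abs_nonneg _).trans (h 1)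
  have mulle : ∀ {a b c d : ℝ}, |a| ≤ c → |b| ≤ d → |a * b| ≤ c * d := fun ha hb => by
    rw [abs_mul]; exact mul_le_mul ha hb (abs_nonneg _) ((abs_nonneg _).trans ha)
  have h2 : ∀ g k, |p g * p k - q g * q k| ≤ 2 * δ := by
    intro g k
    have e : p g * p k - q g * q k = p g * (p k - q k) + (p g - q g) * q k := by ring
    rw [e]
    have := mulle (hp g) (h k)
    have := mulle (h g) (hq k)
    refine (abs_add_le _ _).trans (by linarith)
  have h3 : ∀ g k l, |p g * (p k * p l) - q g * (q k * q l)| ≤ 3 * δ := by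
    intro g k l
    have e : p g * (p k * p l) - q g * (q k * q l) =
      p g * (p k * p l - q k * q l) + (p g - q g) * (q k * q l) := by ring
    rw [e]
    have := mulle (hp g) (h2 k l)
    have := mulle (h g) (mulle (hq k) (hq l))
    refine (abs_add_le _ _).trans (by linarith)
  have e1 : |energy p - energy q| ≤ 2 * Fintype.card G * δ := by
    rw [energy, energy, ← Finset.sum_sub_distrib]
    have e0 : ∀ g, |p g ^ 2 - q g ^ 2| ≤ 2 * δ := fun g => by rw [sq, sq]; exact h2 g g
    refine (Finset.abs_sum_le_sum_abs _ _).trans ((Finset.sum_le_sum fun g _ => e0 g).trans ?_)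
    simp only [Finset.sum_const, Finset.card_univ, nsmul_eq_mul]
    linarith
  have e2 : |∑ g, p g * conv p g - ∑ g, q g * conv q g| ≤
      3 * (Fintype.card G : ℝ) ^ 2 * δ := by
    simp only [conv, Finset.mul_sum]
    simp only [← Finset.sum_sub_distrib]
    refine (Finset.abs_sum_le_sum_abs _ _).trans
      ((Finset.sum_le_sum fun g _ => (Finset.abs_sum_le_sum_abs _ _).trans
        (Finset.sum_le_sum fun k _ => h3 _ _ _)).trans ?_)
    simp only [Finset.sum_const, Finset.card_univ, nsmul_eq_mul]
    linarith
  have e : dissipation p - dissipation q =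
      (energy p - energy q) - (∑ g, p g * conv p g - ∑ g, q g * conv q g) := by
    simp only [dissipation]; ring
  rw [e]
  refine (abs_sub _ _).trans (by linarith)

end Lipschitz

/-! ### Functions of the first n labels as finite sums -/

section Path

variable {G Ω : Type*} {X : ℕ → Ω → G}

/-- The sequence of all labels. -/
def path (X : ℕ → Ω → G) (ω : Ω) : ℕ → G := fun k => X k ω

/-- Prolong a finite sequence by the neutral element. -/
def prolong [Group G] {n : ℕ} (x : Fin n → G) (k : ℕ) : G := if h : k < n then x ⟨k, h⟩ else 1

theorem prolong_apply [Group G] {n : ℕ} (x : Fin n → G) (i : Fin n) : prolong x i = x i := dif_pos i.2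

theorem apply_path_eq [Group G] {F : (ℕ → G) → ℝ} {n : ℕ} (hF : DependsOn F (Set.Iio n)) (ω : Ω) :
    F (path X ω) = F (prolong (content X n ω)) :=
  hF fun i hi => by simp only [prolong, dif_pos (Set.mem_Iio.1 hi)]; rfl

theorem apply_path_eq_sum [Group G] [Fintype G] {F : (ℕ → G) → ℝ} {n : ℕ}
    (hF : DependsOn F (Set.Iio n)) :
    (fun ω => F (path X ω)) =
      fun ω => ∑ x : Fin n → G, {ω | content X n ω = x}.indicator (fun _ => F (prolong x)) ω := by
  classical
  funext ω
  rw [apply_path_eq hF ω, Finset.sum_eq_single (content X n ω)]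
  · rw [Set.indicator_of_mem]; rfl
  · intro x _ hx
    have h : ω ∉ {ω | content X n ω = x} := fun h => hx (Eq.symm h)
    rw [Set.indicator_of_notMem h]
  · simp

end Path

/-! ### Expectations and the one-step law of the urn -/

section UrnExpectation

variable {G Ω : Type*} [Group G] [MeasurableSpace Ω] {P : Measure Ω} {r : ℕ} {gen : Fin r → G}
  {X : ℕ → Ω → G}

theorem IsUrnProcess.measurableSet_content (hX : IsUrnProcess P gen X) {n : ℕ} (x : Fin n → G) :
    MeasurableSet {ω | content X n ω = x} := by
  have : {ω | content X n ω = x} = ⋂ i : Fin n, {ω | X i ω = x i} := by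
    ext ω; simp [content, funext_iff]
  rw [this]
  exact MeasurableSet.iInter fun i => hX.measurable _ _

theorem IsUrnProcess.measurable_path [Fintype G] (hX : IsUrnProcess P gen X)
    {F : (ℕ → G) → ℝ} {n : ℕ} (hF : DependsOn F (Set.Iio n)) :
    Measurable fun ω => F (path X ω) := by
  rw [apply_path_eq_sum hF]
  exact Finset.measurable_fun_sum _ fun x _ =>
    measurable_const.indicator (hX.measurableSet_content x)

theorem IsUrnProcess.integrable_path [Fintype G] [IsFiniteMeasure P] (hX : IsUrnProcess P gen X)
    {F : (ℕ → G) → ℝ} {n : ℕ} (hF : DependsOn F (Set.Iio n)) :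
    Integrable (fun ω => F (path X ω)) P := by
  rw [apply_path_eq_sum hF]
  exact integrable_finsetSum _ fun x _ =>
    (integrable_const _).indicator (hX.measurableSet_content x)

theorem IsUrnProcess.integral_path [Fintype G] [IsFiniteMeasure P] (hX : IsUrnProcess P gen X)
    {F : (ℕ → G) → ℝ} {n : ℕ} (hF : DependsOn F (Set.Iio n)) :
    ∫ ω, F (path X ω) ∂P =
      ∑ x : Fin n → G, P.real {ω | content X n ω = x} * F (prolong x) := by
  rw [apply_path_eq_sum hF, integral_finsetSum _ fun x _ =>
    (integrable_const _).indicator (hX.measurableSet_content x)]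
  refine Finset.sum_congr rfl fun x _ => ?_
  rw [integral_indicator_const _ (hX.measurableSet_content x), smul_eq_mul]

/-- The expectation of `F` after the next draw, given the first `n` labels. -/
noncomputable def drawExp [Fintype G] (n : ℕ) (F : (ℕ → G) → ℝ) (y : ℕ → G) : ℝ :=
  ∑ g, drawProb (fun i : Fin n => y i) g * F (Function.update y n g)

theorem dependsOn_drawExp [Fintype G] {n : ℕ} {F : (ℕ → G) → ℝ}
    (hF : DependsOn F (Set.Iio (n + 1))) : DependsOn (drawExp n F) (Set.Iio n) := by
  intro y z h
  have h1 : (fun i : Fin n => y i) = fun i : Fin n => z i := funext fun i => h i i.2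
  rw [drawExp, drawExp, h1]
  refine Finset.sum_congr rfl fun g _ => ?_
  congr 1
  refine hF fun i hi => ?_
  rcases (Nat.lt_succ_iff.1 (Set.mem_Iio.1 hi)).eq_or_lt with rfl | hi
  · simp
  · rw [Function.update_of_ne hi.ne, Function.update_of_ne hi.ne]
    exact h i hi

/-- The tower property, as a finite sum: split a word of length n + 1 into its first n letters and
its last, and apply the step law. -/
theorem IsUrnProcess.integral_path_succ [Fintype G] [IsFiniteMeasure P]
    (hX : IsUrnProcess P gen X) {n : ℕ} (hn : r ≤ n) {F : (ℕ → G) → ℝ}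
    (hF : DependsOn F (Set.Iio (n + 1))) :
    ∫ ω, F (path X ω) ∂P = ∫ ω, drawExp n F (path X ω) ∂P := by
  rw [hX.integral_path hF, hX.integral_path (dependsOn_drawExp hF),
    ← (Fin.snocEquiv fun _ : Fin (n + 1) => G).sum_comp, Fintype.sum_prod_type_right]
  refine Finset.sum_congr rfl fun x _ => ?_
  rw [drawExp, Finset.mul_sum]
  refine Finset.sum_congr rfl fun g _ => ?_
  have h1 : {ω | content X (n + 1) ω = Fin.snocEquiv (fun _ : Fin (n + 1) => G) (g, x)} =
      {ω | content X n ω = x ∧ X n ω = g} := by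
    ext ω
    simp only [Set.mem_ofPred_eq, funext_iff, Fin.forall_fin_succ', Fin.snocEquiv, Equiv.coe_fn_mk,
      Fin.snoc_castSucc, Fin.snoc_last]
    rfl
  have h2 : (fun i : Fin n => prolong x i) = x := funext (prolong_apply x)
  rw [h1, hX.step n hn, h2, mul_assoc]
  congr 2
  refine hF fun i hi => ?_
  rcases (Nat.lt_succ_iff.1 (Set.mem_Iio.1 hi)).eq_or_lt with rfl | hi'
  · simp [prolong, Fin.snocEquiv, Fin.snoc]
  · rw [Function.update_of_ne hi'.ne]
    simp [prolong, Fin.snocEquiv, Fin.snoc, hi', hi'.trans (Nat.lt_succ_self n)]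

theorem IsUrnProcess.integral_path_succ_le [Fintype G] [IsFiniteMeasure P]
    (hX : IsUrnProcess P gen X) {n : ℕ} (hn : r ≤ n) {F F' : (ℕ → G) → ℝ}
    (hF : DependsOn F (Set.Iio (n + 1))) (hF' : DependsOn F' (Set.Iio n))
    (h : ∀ᵐ ω ∂P, drawExp n F (path X ω) ≤ F' (path X ω)) :
    ∫ ω, F (path X ω) ∂P ≤ ∫ ω, F' (path X ω) ∂P := by
  rw [hX.integral_path_succ hn hF]
  exact integral_mono_ae (hX.integrable_path (dependsOn_drawExp hF)) (hX.integrable_path hF') h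

end UrnExpectation

/-! ### The escape functional for a proper subgroup -/

section Escape

variable {G : Type*}

/-- Only the count of g changes, by one, so the sum of squared counts grows by twice that count plus
1. -/
theorem energy_pathFreq_update [Fintype G] {n : ℕ} (y : ℕ → G) (g : G) :
    (n + 1 : ℝ) ^ 2 * energy (pathFreq (n + 1) (Function.update y n g)) =
      n ^ 2 * energy (pathFreq n y) + 2 * n * pathFreq n y g + 1 := by
  classical
  have h : ∀ k, (n + 1 : ℝ) ^ 2 * pathFreq (n + 1) (Function.update y n g) k ^ 2 =
      n ^ 2 * pathFreq n y k ^ 2 + (if g = k then 2 * n * pathFreq n y k + 1 else 0) := by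
    intro k
    rw [← mul_pow, mul_pathFreq_succ, DependsOn.update_eq (dependsOn_pathFreq n) y le_rfl,
      Function.update_self]
    split_ifs <;> ring
  rw [energy, energy, Finset.mul_sum, Finset.mul_sum, Finset.sum_congr rfl fun k _ => h k,
    Finset.sum_add_distrib, Finset.sum_ite_eq, if_pos (Finset.mem_univ _), add_assoc]

open Classical in
/-- A nonnegative supermartingale that blows up when, from time `m` on, the proportion outside `S`
stays at most `1 / 8` and tends to zero. -/
noncomputable def escape (S : Set G) (m n : ℕ) (y : ℕ → G) : ℝ :=
  if ∀ k, m ≤ k → k < n → countOutside S k y ≤ k / 8 then n / (countOutside S n y - 1 / 2) else 0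

theorem dependsOn_escape (S : Set G) (m n : ℕ) : DependsOn (escape S m n) (Set.Iio n) := by
  intro y z h
  have h1 : ∀ k ≤ n, countOutside S k y = countOutside S k z := fun k hk =>
    (dependsOn_countOutside S k).mono (Set.Iio_subset_Iio hk) h
  have h2 : (∀ k, m ≤ k → k < n → countOutside S k y ≤ k / 8) ↔
      ∀ k, m ≤ k → k < n → countOutside S k z ≤ k / 8 :=
    forall_congr' fun k => imp_congr_right fun _ => forall_congr' fun hk => by rw [h1 k hk.le]
  simp only [escape, h1 n le_rfl, h2]

theorem escape_nonneg {S : Set G} {n : ℕ} {y : ℕ → G} (h : 1 ≤ countOutside S n y) (m : ℕ) :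
    0 ≤ escape S m n y := by
  rw [escape]
  split_ifs
  · exact div_nonneg (by positivity) (by linarith)
  · exact le_rfl

/-- The functional is never switched off here and dominates the inverse of the proportion outside S.
-/
theorem tendsto_escape {S : Set G} {m : ℕ} {y : ℕ → G}
    (h1 : ∀ᶠ n in atTop, 1 ≤ countOutside S n y)
    (hc : ∀ k : ℕ, m ≤ k → countOutside S k y ≤ k / 8)
    (h0 : Tendsto (fun n : ℕ => countOutside S n y / n) atTop (𝓝 0)) :
    Tendsto (fun n => escape S m n y) atTop atTop := by
  have hpos : ∀ᶠ n in atTop, (0 : ℝ) < countOutside S n y / n := by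
    filter_upwards [h1, eventually_gt_atTop 0] with n hn hn0
    have : (0 : ℝ) < n := by exact_mod_cast hn0
    exact div_pos (by linarith) this
  have hinf := (tendsto_inv_nhdsGT_zero (𝕜 := ℝ)).comp
    (tendsto_nhdsWithin_iff.2 ⟨h0, hpos⟩)
  refine tendsto_atTop_mono' _ ?_ hinf
  filter_upwards [h1] with n hn
  rw [escape, if_pos fun k hk _ => hc k hk, Function.comp_apply, inv_div]
  exact div_le_div_of_nonneg_left (by positivity) (by linarith) (by linarith)

theorem exists_generator_notMem [Group G] {r : ℕ} {gen : Fin r → G}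
    (hgen : Subgroup.closure (Set.range gen) = ⊤) {H : Subgroup G}
    (hH : H ≠ ⊤) : ∃ i, gen i ∉ H := by
  by_contra! h
  refine hH (top_le_iff.1 (hgen ▸ (Subgroup.closure_le H).2 ?_))
  rintro _ ⟨i, rfl⟩
  exact h i

theorem one_le_countOutside [Group G] {Ω : Type*} {X : ℕ → Ω → G} {r : ℕ}
    {gen : Fin r → G} (hgen : Subgroup.closure (Set.range gen) = ⊤) {H : Subgroup G}
    (hH : H ≠ ⊤) {ω : Ω} (hω : content X r ω = gen) {n : ℕ} (hn : r ≤ n) :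
    1 ≤ countOutside (H : Set G) n (path X ω) := by
  obtain ⟨i, hi⟩ := exists_generator_notMem hgen hH
  rw [← hω] at hi
  refine le_trans ?_ (countOutside_mono (H : Set G) (path X ω) hn)
  have h := Finset.single_le_sum (f := fun i => (H : Set G)ᶜ.indicator (fun _ => (1 : ℝ))
    (path X ω i)) (fun _ _ => Set.indicator_nonneg (fun _ _ => zero_le_one) _)
    (Finset.mem_range.2 i.2)
  have hmem : path X ω i ∈ (H : Set G)ᶜ := hi
  simp only [Set.indicator_of_mem hmem] at h
  exact h

end Escape

/-! ### Almost sure convergence -/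

section Convergence

variable {G Ω : Type*} [Group G] [Fintype G] [MeasurableSpace Ω] {P : Measure Ω}
  [IsProbabilityMeasure P] {r : ℕ} {gen : Fin r → G} {X : ℕ → Ω → G}

theorem drawExp_energy_le {n : ℕ} (hn : 0 < n) (y : ℕ → G) :
    drawExp n (fun z => energy (pathFreq (n + 1) z)) y ≤
      energy (pathFreq n y) - dissipation (pathFreq n y) / (n + 1) + 1 / ((n : ℝ) + 1) ^ 2 := by
  have hp : pathFreq n y ∈ stdSimplex ℝ G := freq_mem_stdSimplex hn _
  have hn1 : (1 : ℝ) ≤ n := by exact_mod_cast hn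
  have h : (n + 1 : ℝ) ^ 2 * drawExp n (fun z => energy (pathFreq (n + 1) z)) y =
      n ^ 2 * energy (pathFreq n y) + 2 * n * ∑ g, pathFreq n y g * conv (pathFreq n y) g + 1 := by
    rw [drawExp, Finset.mul_sum]
    have e : ∀ g, (n + 1 : ℝ) ^ 2 * (drawProb (fun i : Fin n => y i) g *
        energy (pathFreq (n + 1) (Function.update y n g))) =
        conv (pathFreq n y) g * (n ^ 2 * energy (pathFreq n y) + 1) +
          2 * n * (pathFreq n y g * conv (pathFreq n y) g) := by
      intro g
      rw [mul_left_comm, energy_pathFreq_update, drawProb_eq_conv]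
      change conv (pathFreq n y) g * _ = _
      ring
    rw [Finset.sum_congr rfl fun g _ => e g, Finset.sum_add_distrib, ← Finset.sum_mul,
      (conv_mem_stdSimplex hp).2, ← Finset.mul_sum]
    ring
  have hd := dissipation_nonneg hp
  have he := energy_nonneg (pathFreq n y)
  have hs : ∑ g, pathFreq n y g * conv (pathFreq n y) g =
      energy (pathFreq n y) - dissipation (pathFreq n y) := by rw [dissipation]; ring
  rw [hs] at h
  have hpos : (0 : ℝ) < (n + 1 : ℝ) ^ 2 := by positivity
  refine le_of_mul_le_mul_left ?_ hpos
  rw [h]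
  have e : (n + 1 : ℝ) ^ 2 * (energy (pathFreq n y) - dissipation (pathFreq n y) / (n + 1) +
      1 / ((n : ℝ) + 1) ^ 2) = (n + 1 : ℝ) ^ 2 * energy (pathFreq n y) -
        (n + 1) * dissipation (pathFreq n y) + 1 := by field_simp
  rw [e]
  -- Uses n² + 2n = (n + 1)² - 1 and 2n ≥ n + 1, with energy and dissipation nonnegative.
  nlinarith

/-- The energy inequality telescopes in expectation; as energy is nonnegative, the expected
dissipation terms have a finite sum, and nonnegative terms with summable L¹ norms are almost surely
summable. -/
theorem IsUrnProcess.ae_summable_dissipation (hr : 0 < r) (hX : IsUrnProcess P gen X) :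
    ∀ᵐ ω ∂P, Summable fun n : ℕ => dissipation (pathFreq n (path X ω)) / (n + 1) := by
  have dE : ∀ n, DependsOn (fun y : ℕ → G => energy (pathFreq n y)) (Set.Iio n) :=
    fun n _ _ h => by simp only [dependsOn_pathFreq n h]
  have dD : ∀ n : ℕ, DependsOn (fun y : ℕ → G => dissipation (pathFreq n y) / ((n : ℝ) + 1))
    (Set.Iio n) := fun n _ _ h => by simp only [dependsOn_pathFreq n h]
  let V : ℕ → ℝ := fun n => ∫ ω, energy (pathFreq n (path X ω)) ∂P
  let D : ℕ → ℝ := fun n => ∫ ω, dissipation (pathFreq n (path X ω)) / ((n : ℝ) + 1) ∂P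
  have nonneg : ∀ n, r ≤ n → ∀ ω, 0 ≤ dissipation (pathFreq n (path X ω)) / ((n : ℝ) + 1) :=
    fun n hn ω => div_nonneg (dissipation_nonneg (freq_mem_stdSimplex (hr.trans_le hn) _))
      (by positivity)
  have step : ∀ n, r ≤ n → V (n + 1) ≤ V n - D n + 1 / ((n : ℝ) + 1) ^ 2 := by
    intro n hn
    have h := hX.integral_path_succ_le hn (dE (n + 1))
      (F' := fun y => energy (pathFreq n y) - dissipation (pathFreq n y) / ((n : ℝ) + 1) +
        1 / ((n : ℝ) + 1) ^ 2)
      (fun _ _ h => by simp only [dependsOn_pathFreq n h])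
      (ae_of_all _ fun ω => drawExp_energy_le (hr.trans_le hn) _)
    have hi := (hX.integrable_path (dE n)).sub (hX.integrable_path (dD n))
    simp only [Pi.sub_def] at hi
    rw [integral_add hi (integrable_const _), integral_sub (hX.integrable_path (dE n))
      (hX.integrable_path (dD n))] at h
    simpa using h
  have hsq : Summable fun n : ℕ => 1 / ((n : ℝ) + 1) ^ 2 := by
    have := (summable_nat_add_iff 1).2 (Real.summable_one_div_nat_pow.2 one_lt_two)
    simpa using this
  have hsq' : Summable fun n : ℕ => 1 / (((n + r : ℕ) : ℝ) + 1) ^ 2 := (summable_nat_add_iff r).2 hsq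
  have hsum : Summable fun n => D (n + r) := by
    refine summable_of_sum_range_le (c := V r + ∑' n : ℕ, 1 / (((n + r : ℕ) : ℝ) + 1) ^ 2)
      (fun n => integral_nonneg (nonneg _ (Nat.le_add_left _ _))) fun m => ?_
    have h1 : ∑ n ∈ Finset.range m, D (n + r) ≤
        V r - V (m + r) + ∑ n ∈ Finset.range m, 1 / (((n + r : ℕ) : ℝ) + 1) ^ 2 := by
      induction m with
      | zero => simp
      | succ m ih =>
        rw [Finset.sum_range_succ, Finset.sum_range_succ]
        have := step (m + r) (Nat.le_add_left _ _)
        rw [Nat.add_right_comm m 1 r]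
        linarith
    have h2 : 0 ≤ V (m + r) := integral_nonneg fun ω => energy_nonneg _
    have h3 := hsq'.sum_le_tsum (Finset.range m) fun n _ => by positivity
    linarith
  have hfin : ∑' n : ℕ, eLpNorm (fun ω => dissipation (pathFreq (n + r) (path X ω)) /
      (((n + r : ℕ) : ℝ) + 1)) 1 P ≠ ⊤ := by
    have e : ∀ n : ℕ, eLpNorm (fun ω => dissipation (pathFreq (n + r) (path X ω)) /
        (((n + r : ℕ) : ℝ) + 1)) 1 P = ENNReal.ofReal (D (n + r)) := by
      intro n
      rw [eLpNorm_one_eq_lintegral_enorm, ← ofReal_integral_norm_eq_lintegral_enorm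
        (hX.integrable_path (dD (n + r)))]
      congr 1
      exact integral_congr_ae (ae_of_all _ fun ω =>
        Real.norm_of_nonneg (nonneg _ (Nat.le_add_left _ _) ω))
    simp only [e]
    exact hsum.tsum_ofReal_ne_top
  filter_upwards [summable_norm_of_tsum_eLpNorm_ne_top le_rfl
    (fun n => (hX.integrable_path (dD (n + r))).aestronglyMeasurable) hfin] with ω hω
  exact (summable_nat_add_iff r).1 hω.of_norm

theorem tendsto_pathFreq_of_summable {y : ℕ → G}
    (hs : Summable fun n : ℕ => dissipation (pathFreq n y) / (n + 1)) :
    ∃ H : Subgroup G, Tendsto (fun n => pathFreq n y) atTop (𝓝 (unif (H : Set G))) := by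
  have hmem : ∀ n, 0 < n → pathFreq n y ∈ stdSimplex ℝ G := fun n hn => freq_mem_stdSimplex hn _
  have habs : ∀ n g, |pathFreq n y g| ≤ 1 := fun n g => by
    rw [abs_of_nonneg (pathFreq_nonneg n y g)]; exact pathFreq_le_one n y g
  -- The empty urn has frequency vector 0, outside the simplex.
  have hzero : dissipation (pathFreq 0 y) = 0 := by
    have : pathFreq 0 y = 0 := by funext g; simp [pathFreq, freq]
    simp [this, dissipation, energy, conv]
  have hφ : Tendsto (fun n => dissipation (pathFreq n y)) atTop (𝓝 0) := by
    refine tendsto_zero_of_summable_div (fun n => ?_)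
      (C := 2 * Fintype.card G + 3 * (Fintype.card G : ℝ) ^ 2) (fun n => ?_) hs
    · rcases n.eq_zero_or_pos with rfl | hn
      · exact hzero.ge
      · exact dissipation_nonneg (hmem n hn)
    · rw [← mul_one_div]
      exact abs_dissipation_sub_le (habs _) (habs _) (abs_pathFreq_succ_sub_le n y)
  have hfinite : (Set.range fun H : Subgroup G => unif (H : Set G)).Finite := Set.finite_range _
  have hdist := tendsto_infDist_of_tendsto_zero
    (F := Set.range fun H : Subgroup G => unif (H : Set G)) (isCompact_stdSimplex ℝ G)
    continuous_dissipation
    (fun z hz hzF => lt_of_le_of_ne (dissipation_nonneg hz) fun h0 => hzF <| by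
      obtain ⟨H, rfl⟩ := exists_eq_unif_of_dissipation_eq_zero hz h0.symm
      exact ⟨H, rfl⟩)
    (x := fun n => pathFreq n y) ((eventually_gt_atTop 0).mono hmem) hφ
  have hstep : Tendsto (fun n => dist (pathFreq n y) (pathFreq (n + 1) y)) atTop (𝓝 0) := by
    refine squeeze_zero (fun _ => dist_nonneg) (fun n => ?_)
      tendsto_one_div_add_atTop_nhds_zero_nat
    rw [dist_comm]
    exact (dist_pi_le_iff (by positivity)).2 (abs_pathFreq_succ_sub_le n y)
  obtain ⟨_, ⟨H, rfl⟩, h⟩ :=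
    exists_tendsto_of_infDist_finite hfinite (Set.range_nonempty _) hdist hstep
  exact ⟨H, h⟩

/-- Let N be the count outside H and q the chance that the next ball falls outside. The expectation
is (n + 1)/(N - 1/2) · (1 - q/(N + 1/2)), so the claim amounts to q(n + 1) ≥ N + 1/2. The available
bound is q n ≥ 7N/4; without the shift by 1/2 one would need N + 1 instead, which 7N/4 does not
reach at N = 1. -/
theorem drawExp_escape_le (H : Subgroup G) {m n : ℕ} (hmn : m ≤ n) (hn : 0 < n) {y : ℕ → G}
    (hy : 1 ≤ countOutside (H : Set G) n y) :
    drawExp n (escape (H : Set G) m (n + 1)) y ≤ escape (H : Set G) m n y := by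
  classical
  have hup : ∀ g, ∀ k ≤ n,
      countOutside (H : Set G) k (Function.update y n g) = countOutside (H : Set G) k y :=
    fun g k hk => DependsOn.update_eq (dependsOn_countOutside _ k) y hk g
  -- The condition at time n + 1 concerns counts up to n only, so it is settled before the draw.
  by_cases hc : ∀ k, m ≤ k → k < n + 1 → countOutside (H : Set G) k y ≤ k / 8
  swap
  · have : drawExp n (escape (H : Set G) m (n + 1)) y = 0 := by
      refine Finset.sum_eq_zero fun g _ => ?_
      rw [escape, if_neg, mul_zero]
      refine fun h => hc fun k hk hkn => ?_
      rw [← hup g k (Nat.lt_succ_iff.1 hkn)]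
      exact h k hk hkn
    rw [this]
    exact escape_nonneg hy m
  have hE : escape (H : Set G) m n y = n / (countOutside (H : Set G) n y - 1 / 2) :=
    if_pos fun k hk hkn => hc k hk (hkn.trans (Nat.lt_succ_self n))
  have hEg : ∀ g, escape (H : Set G) m (n + 1) (Function.update y n g) =
      ((n + 1 : ℕ) : ℝ) / (countOutside (H : Set G) n y +
        offSupport (unif (H : Set G)) g - 1 / 2) := by
    intro g
    rw [escape, if_pos, countOutside_succ, hup g n le_rfl, Function.update_self]
    · congr 3
      simp only [offSupport, Set.indicator_apply, Set.mem_ofPred_eq, unif_eq_zero_iff,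
        Set.mem_compl_iff]
    · intro k hk hkn
      rw [hup g k (Nat.lt_succ_iff.1 hkn)]
      exact hc k hk hkn
  have hN := hc n hmn (Nat.lt_succ_self n)
  have hp : pathFreq n y ∈ stdSimplex ℝ G := freq_mem_stdSimplex hn _
  have hq := le_offSupport_dotProduct_conv H hp
  rw [offSupport_dotProduct_freq] at hq
  set N := countOutside (H : Set G) n y
  set c := offSupport (unif (H : Set G)) with hcdef
  set q := c ⬝ᵥ conv (pathFreq n y)
  have hn0 : (0 : ℝ) < n := by exact_mod_cast hn
  have hN1 : (0 : ℝ) < N - 1 / 2 := by linarith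
  have hN2 : (0 : ℝ) < N + 1 / 2 := by linarith
  have hc01 : ∀ g, c g = 0 ∨ c g = 1 := fun g => by
    simp only [hcdef, offSupport, Set.indicator_apply]
    split_ifs <;> simp
  have hval : drawExp n (escape (H : Set G) m (n + 1)) y =
      (n + 1) / (N - 1 / 2) - q * ((n + 1) / ((N - 1 / 2) * (N + 1 / 2))) := by
    have e : ∀ g, drawProb (fun i : Fin n => y i) g *
        escape (H : Set G) m (n + 1) (Function.update y n g) =
        conv (pathFreq n y) g * ((n + 1) / (N - 1 / 2)) -
          (c g * conv (pathFreq n y) g) * ((n + 1) / ((N - 1 / 2) * (N + 1 / 2))) := by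
      intro g
      rw [hEg, drawProb_eq_conv]
      change conv (pathFreq n y) g * _ = _
      push_cast
      rcases hc01 g with h | h
      · rw [h]; simp
      · have : N + 1 - 1 / 2 = N + 1 / 2 := by ring
        have hu : N - 1 / 2 ≠ 0 := hN1.ne'
        have hv : N + 1 / 2 ≠ 0 := hN2.ne'
        have key : (n + 1 : ℝ) / (N + 1 / 2) =
            (n + 1) / (N - 1 / 2) - (n + 1) / ((N - 1 / 2) * (N + 1 / 2)) := by
          rw [eq_sub_iff_add_eq, ← mul_div_mul_left _ _ hu, ← add_div,
            div_eq_div_iff (mul_ne_zero hu hv) hu]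
          ring
        rw [h, this, key]
        ring
    rw [drawExp, Finset.sum_congr rfl fun g _ => e g, Finset.sum_sub_distrib, ← Finset.sum_mul,
      ← Finset.sum_mul, (conv_mem_stdSimplex hp).2, one_mul]
    rfl
  have hε : N / n ≤ 1 / 8 := by rw [div_le_iff₀ hn0]; linarith
  have hε0 : 0 ≤ N / n := div_nonneg (by linarith) hn0.le
  -- From 2ε(1 - ε) ≤ q with ε = N/n ≤ 1/8.
  have hq1 : 7 / 4 * (N / n) ≤ q := by nlinarith
  have hq2 : N + 1 / 2 ≤ q * (n + 1) := by
    have h1 : 7 / 4 * (N / n) * n = 7 / 4 * N := by field_simp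
    nlinarith
  rw [hval, hE]
  have e : (n + 1) / (N - 1 / 2) - q * ((n + 1) / ((N - 1 / 2) * (N + 1 / 2))) =
      ((n + 1) - q * (n + 1) / (N + 1 / 2)) / (N - 1 / 2) := by
    field_simp
  rw [e]
  have h1 : 1 ≤ q * (n + 1) / (N + 1 / 2) := by rwa [le_div_iff₀ hN2, one_mul]
  gcongr
  linarith

/-- By Fatou, almost surely for every starting time m ≥ r the functional has finite liminf.
Convergence to u_H would keep the outside proportion below 1/8 from some m on and make the
functional started at that m diverge. -/
theorem IsUrnProcess.ae_not_tendsto (hr : 0 < r)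
    (hgen : Subgroup.closure (Set.range gen) = ⊤) (hX : IsUrnProcess P gen X) {H : Subgroup G}
    (hH : H ≠ ⊤) :
    ∀ᵐ ω ∂P, ¬ Tendsto (fun n => pathFreq n (path X ω)) atTop (𝓝 (unif (H : Set G))) := by
  have hone : ∀ᵐ ω ∂P, ∀ n, r ≤ n → 1 ≤ countOutside (H : Set G) n (path X ω) := by
    filter_upwards [hX.initial] with ω hω n hn
    exact one_le_countOutside hgen hH hω hn
  have hint : ∀ m n, Integrable (fun ω => escape (H : Set G) m n (path X ω)) P := fun m n =>
    hX.integrable_path (dependsOn_escape (H : Set G) m n)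
  have hbound : ∀ m, r ≤ m → ∀ n, m ≤ n →
      ∫ ω, escape (H : Set G) m n (path X ω) ∂P ≤ ∫ ω, escape (H : Set G) m m (path X ω) ∂P := by
    intro m hm n hn
    induction n, hn using Nat.le_induction with
    | base => exact le_rfl
    | succ n hn ih =>
      refine le_trans (hX.integral_path_succ_le (hm.trans hn) (dependsOn_escape _ _ _)
        (dependsOn_escape _ _ _) ?_) ih
      filter_upwards [hone] with ω hω
      exact drawExp_escape_le H hn (hr.trans_le (hm.trans hn)) (hω n (hm.trans hn))
  have hfin : ∀ᵐ ω ∂P, ∀ m, r ≤ m →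
      liminf (fun n => ENNReal.ofReal (escape (H : Set G) m n (path X ω))) atTop < ⊤ := by
    rw [ae_all_iff]
    intro m
    by_cases hm : r ≤ m
    swap
    · exact ae_of_all _ fun _ h => absurd h hm
    have hmeas : ∀ n, Measurable
        fun ω => ENNReal.ofReal (escape (H : Set G) m n (path X ω)) := fun n =>
      (hX.measurable_path (dependsOn_escape (H : Set G) m n)).ennreal_ofReal
    have hle : ∫⁻ ω, liminf (fun n => ENNReal.ofReal (escape (H : Set G) m n (path X ω))) atTop ∂P
        ≤ ENNReal.ofReal (∫ ω, escape (H : Set G) m m (path X ω) ∂P) := by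
      refine (lintegral_liminf_le hmeas).trans ?_
      refine liminf_le_of_frequently_le' (Eventually.frequently ?_)
      filter_upwards [eventually_ge_atTop m] with n hn
      rw [← ofReal_integral_eq_lintegral_ofReal (hint m n)]
      · exact ENNReal.ofReal_le_ofReal (hbound m hm n hn)
      · filter_upwards [hone] with ω hω
        exact escape_nonneg (hω n (hm.trans hn)) m
    filter_upwards [ae_lt_top (Measurable.liminf hmeas)
      (ne_top_of_le_ne_top ENNReal.ofReal_ne_top hle)] with ω hω _
    exact hω
  filter_upwards [hone, hfin] with ω h1 h2 htend
  have hcont : Continuous fun p : G → ℝ => offSupport (unif (H : Set G)) ⬝ᵥ p := by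
    unfold dotProduct; fun_prop
  have h0 : offSupport (unif (H : Set G)) ⬝ᵥ unif (H : Set G) = 0 := offSupport_dotProduct_self _
  have hlim := (hcont.tendsto _).comp htend
  rw [h0] at hlim
  replace hlim : Tendsto (fun n : ℕ => countOutside (H : Set G) n (path X ω) / n) atTop (𝓝 0) :=
    hlim.congr fun n => offSupport_dotProduct_freq _ _ _
  obtain ⟨m, hm⟩ := eventually_atTop.1
    ((hlim.eventually (gt_mem_nhds (show (0 : ℝ) < 1 / 8 by norm_num))).and
      (eventually_ge_atTop r))
  have hinf := tendsto_escape (eventually_atTop.2 ⟨r, h1⟩) (m := m) (fun k hk => by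
    have h3 := (hm k hk).1
    have hk0 : (0 : ℝ) < k := by exact_mod_cast hr.trans_le (hm k hk).2
    rw [div_lt_iff₀ hk0] at h3
    linarith) hlim
  have := (ENNReal.tendsto_ofReal_atTop.comp hinf).liminf_eq
  exact (h2 m (hm m le_rfl).2).ne this

theorem IsUrnProcess.ae_tendsto_pathFreq (hr : 0 < r)
    (hgen : Subgroup.closure (Set.range gen) = ⊤) (hX : IsUrnProcess P gen X) :
    ∀ᵐ ω ∂P, Tendsto (fun n => pathFreq n (path X ω)) atTop (𝓝 (unif Set.univ)) := by
  have hnot : ∀ᵐ ω ∂P, ∀ H : Subgroup G, H ≠ ⊤ →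
      ¬ Tendsto (fun n => pathFreq n (path X ω)) atTop (𝓝 (unif (H : Set G))) :=
    ae_all_iff.2 fun H => by
      by_cases hH : H = ⊤
      · exact ae_of_all _ fun _ h => absurd hH h
      · filter_upwards [hX.ae_not_tendsto hr hgen hH] with ω hω _ using hω
  filter_upwards [hX.ae_summable_dissipation hr, hnot] with ω h1 h2
  obtain ⟨H, hH⟩ := tendsto_pathFreq_of_summable h1
  have : H = ⊤ := by
    by_contra h
    exact h2 H h hH
  rwa [this, Subgroup.coe_top] at hH

theorem offSupport_dotProduct_generators_pos (hgen : Subgroup.closure (Set.range gen) = ⊤)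
    {H : Subgroup G} (hH : H ≠ ⊤) :
    0 < offSupport (unif (H : Set G)) ⬝ᵥ freq gen := by
  obtain ⟨i, hi⟩ := exists_generator_notMem hgen hH
  have hr : (0 : ℝ) < r := by exact_mod_cast i.pos
  rw [dotProduct, sum_freq_mul]
  refine div_pos (Finset.sum_pos' (fun j _ => Set.indicator_nonneg (fun _ _ => zero_le_one) _)
    ⟨i, Finset.mem_univ _, ?_⟩) hr
  have hmem : gen i ∈ {g | unif (H : Set G) g = 0} := unif_apply_of_notMem hi
  rw [offSupport, Set.indicator_of_mem hmem]
  exact one_pos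

end Convergence

end DiaconisUrn

theorem mainTheorem2 {G : Type*} [Group G] [Fintype G] {r : ℕ} (hr : 0 < r) (gen : Fin r → G)
    (hgen : Subgroup.closure (Set.range gen) = ⊤)
    {Ω : Type*} [MeasurableSpace Ω] (P : Measure Ω) [IsProbabilityMeasure P]
    (X : ℕ → Ω → G) (hX : DiaconisUrn.IsUrnProcess P gen X) :
    -- almost sure convergence of the proportions
    (∀ᵐ ω ∂P, ∀ g : G,
      Tendsto (fun n => DiaconisUrn.freq (DiaconisUrn.content X n ω) g) atTop
        (𝓝 (1 / (Fintype.card G : ℝ)))) ∧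
    -- the fixed points of the convolution map
    (∀ p ∈ stdSimplex ℝ G, DiaconisUrn.conv p ∈ stdSimplex ℝ G) ∧
    {p | p ∈ stdSimplex ℝ G ∧ DiaconisUrn.conv p = p} =
      {p | ∃ H : Subgroup G, p = DiaconisUrn.unif (H : Set G)} ∧
    -- contraction towards the uniform distribution on the group
    (∀ p ∈ stdSimplex ℝ G,
      DiaconisUrn.eDist (DiaconisUrn.conv p) (DiaconisUrn.unif Set.univ) ≤
          DiaconisUrn.eDist p (DiaconisUrn.unif Set.univ) ∧
      (DiaconisUrn.eDist (DiaconisUrn.conv p) (DiaconisUrn.unif Set.univ) =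
          DiaconisUrn.eDist p (DiaconisUrn.unif Set.univ) ↔
        ∃ (H : Subgroup G) (s : G), (∀ h, h ∈ H ↔ s * h * s⁻¹ ∈ H) ∧
          p = DiaconisUrn.unif (s • (H : Set G)))) ∧
    -- every proper subgroup is repelling
    (∀ H : Subgroup G, H ≠ ⊤ →
      0 < DiaconisUrn.offSupport (DiaconisUrn.unif (H : Set G)) ⬝ᵥ DiaconisUrn.freq gen ∧
      1 < liminf
        (fun p : G → ℝ =>
          (((DiaconisUrn.offSupport (DiaconisUrn.unif (H : Set G)) ⬝ᵥ DiaconisUrn.conv p) /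
            (DiaconisUrn.offSupport (DiaconisUrn.unif (H : Set G)) ⬝ᵥ p) : ℝ) : EReal))
        (𝓝[{p | p ∈ stdSimplex ℝ G ∧
            DiaconisUrn.offSupport (DiaconisUrn.unif (H : Set G)) ⬝ᵥ p ≠ 0}]
          (DiaconisUrn.unif (H : Set G)))) := by
  open DiaconisUrn in
  refine ⟨?_, fun p => conv_mem_stdSimplex, ?_,
    fun p hp => ⟨eDist_conv_le hp, eDist_conv_eq_iff hp⟩,
    fun H hH => ⟨offSupport_dotProduct_generators_pos hgen hH, one_lt_liminf_offSupport_ratio H⟩⟩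
  · filter_upwards [hX.ae_tendsto_pathFreq hr hgen] with ω hω g
    have h := (tendsto_pi_nhds.1 hω) g
    rwa [unif_univ] at h
  · ext p
    constructor
    · rintro ⟨hp, h⟩
      exact exists_eq_unif_of_conv_eq hp h
    · rintro ⟨H, rfl⟩
      exact ⟨unif_mem_stdSimplex ⟨1, H.one_mem⟩, conv_unif_subgroup H⟩
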